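/- Let $\Phi$ be a (reduced, crystallographic) root system of type $A_l$ ($l\ge 1$), $D_l$ ($l\ge 4$), $E_6$, $E_7$ or $E_8$, i.e. an irreducible root system all of whose roots have the same length, and let $\alpha_1,\dots,\alpha_l$ be its simple roots, numbered so that the edges of the Dynkin diagram are: for $A_l$, the pairs $\{i,i+1\}$, $1\le i<l$; for $D_l$, the pairs $\{1,3\}$, $\{2,3\}$ and $\{i,i+1\}$, $3\le i<l$; for $E_l$, the pairs $\{1,3\}$, $\{3,4\}$, $\{2,4\}$ and $\{i,i+1\}$, $4\le i<l$. Let $\Pi=\{\alpha_1,\dots,\alpha_l\}$ and let $\Phi^+$ be the set of positive roots. Let $V$ be a Lie algebra over a commutative ring $R$ in which $2\ne0$ (for example $R=\mathbb Z$ or a field of characteristic different from $2$) with a Chevalley basis $\{e_\alpha,\ \alpha\in\Phi;\ h_\alpha,\ \alpha\in\Pi\}$ of type $\Phi$. This means that these elements form an $R$-basis of $V$ and that, for suitable elements $h_\alpha$ ($\alpha\in\Phi$) of the $R$-span of $\{h_\alpha,\ \alpha\in\Pi\}$ and suitable integers $N_{\alpha\beta}$, the following hold for all $\alpha,\beta\in\Phi$: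 $[h_\alpha,h_\beta]=0$; $[h_\alpha,e_\beta]=\frac{2(\alpha,\beta)}{(\alpha,\alpha)}e_\beta$; $[e_\alpha,e_{-\alpha}]=h_\alpha$; if $\alpha+\beta\in\Phi$, then $[e_\alpha,e_\beta]=N_{\alpha\beta}e_{\alpha+\beta}$ and $N_{\alpha\beta}=\pm1$; if $\alpha+\beta\notin\Phi$, then $N_{\alpha\beta}=0$, and $[e_\alpha,e_\beta]=0$ unless $\beta=-\alpha$. (Over a field of characteristic $2$ the integers $N_{\alpha\beta}$ are those of the integral form of the Lie algebra, which is the case $R=\mathbb Z$.) Assume that the basis is positive: $N_{\alpha_i\beta}=1$ whenever $\beta$ and $\alpha_i+\beta$ are positive roots and $i\le j$ for every simple root $\alpha_j$ such that $\alpha_i+\beta=\alpha_j+\delta$ for some $\delta\in\Phi^+$. Then for every simple root $\alpha_i$ and every positive root $\beta$ such that $\beta+\alpha_i$ is a positive root, $$N_{\alpha_i\beta}=-1\iff i>j\ \text{ for every simple root } \alpha_j \text{ occurring with nonzero coefficient in the decomposition of } \beta \text{ into simple roots}.$$ -/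

import Mathlib

/-- The types `A_l` (`l ≥ 1`), `D_l` (`l ≥ 4`), `E_6`, `E_7`, `E_8` of irreducible root systems all
of whose roots have the same length, indexed by their rank. -/
inductive SimplyLacedType : ℕ → Type
  | A (l : ℕ) (hl : 1 ≤ l) : SimplyLacedType l
  | D (l : ℕ) (hl : 4 ≤ l) : SimplyLacedType l
  | E6 : SimplyLacedType 6
  | E7 : SimplyLacedType 7
  | E8 : SimplyLacedType 8

/-- The Cartan matrix, with respect to the following numbering of the nodes of the Dynkin diagram
(the element `k : Fin l` stands for the node with number `k + 1`):
* `A_l`: the path `1 - 2 - ... - l`;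
* `D_l`: the nodes `1` and `2` are both joined to `3`, followed by the path `3 - 4 - ... - l`
  (`CartanMatrix.D` has the fork at the other end, hence the reversal);
* `E_l`: the path `1 - 3 - 4 - ... - l`, with the node `2` joined to `4`. -/
def SimplyLacedType.cartanMatrix : {l : ℕ} → SimplyLacedType l → Matrix (Fin l) (Fin l) ℤ
  | _, .A l _ => CartanMatrix.A l
  | _, .D l _ => (CartanMatrix.D l).submatrix Fin.rev Fin.rev
  | _, .E6 => CartanMatrix.E₆
  | _, .E7 => CartanMatrix.E₇
  | _, .E8 => CartanMatrix.E₈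

/-- A numbering `α_1, …, α_l` of the simple roots is standard of type `t` if the Cartan integers of
the simple roots are given by the Cartan matrix of type `t`. -/
def IsStandardNumbering {ι k M N : Type*} [Finite ι] [Field k] [CharZero k]
    [AddCommGroup M] [Module k M] [AddCommGroup N] [Module k N]
    {P : RootPairing ι k M N} [P.IsCrystallographic] (b : P.Base)
    {l : ℕ} (t : SimplyLacedType l) (α : Fin l ≃ b.support) : Prop :=
  ∀ i j : Fin l, b.cartanMatrix (α i) (α j) = t.cartanMatrix i j

/-- A Chevalley basis `{e_α, α ∈ Φ; h_α, α ∈ Π}` of a Lie algebra `V` over `R`, where `Φ` is a root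
system all of whose roots have the same length, with the set `Π` of simple roots given by `b`.
Roots are referred to by their indices. The integers `N α β` are the structure constants. -/
structure ChevalleyBasis {ι k M N : Type*} [Finite ι] [Field k] [CharZero k]
    [AddCommGroup M] [Module k M] [AddCommGroup N] [Module k N]
    {P : RootPairing ι k M N} [P.IsCrystallographic] (b : P.Base)
    (R V : Type*) [CommRing R] [LieRing V] [LieAlgebra R V] where
  /-- The root vectors. -/
  e : ι → V
  /-- The elements `h_α` of the Cartan subalgebra, for all roots `α`. -/
  h : ι → V
  /-- The structure constants. -/
  N : ι → ι → ℤ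
  linearIndependent : LinearIndependent R (Sum.elim e fun α : b.support ↦ h α)
  span_eq_top : Submodule.span R (Set.range (Sum.elim e fun α : b.support ↦ h α)) = ⊤
  h_mem_span (α : ι) : h α ∈ Submodule.span R (Set.range fun α : b.support ↦ h α)
  lie_h_h (α β : ι) : ⁅h α, h β⁆ = 0
  /-- `[h_α, e_β] = A_{αβ} e_β`, where `A_{αβ} = 2(α, β)/(α, α)` is the value of `α^∨` at `β`. -/
  lie_h_e (α β : ι) : ⁅h α, e β⁆ = P.pairingIn ℤ β α • e β
  lie_e_neg (α β : ι) : P.root β = -P.root α → ⁅e α, e β⁆ = h α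
  lie_e_e (α β γ : ι) : P.root γ = P.root α + P.root β → ⁅e α, e β⁆ = N α β • e γ
  N_eq_one_or (α β γ : ι) : P.root γ = P.root α + P.root β → N α β = 1 ∨ N α β = -1
  lie_e_e_eq_zero (α β : ι) : P.root α + P.root β ∉ Set.range P.root →
    P.root α + P.root β ≠ 0 → ⁅e α, e β⁆ = 0
  N_eq_zero (α β : ι) : P.root α + P.root β ∉ Set.range P.root → N α β = 0

/-- A Chevalley basis is positive, with respect to a numbering `α_1, …, α_l` of the simple roots, if
`N_{α_i β} = 1` whenever `α_i + β = γ` is a positive root (with `β` a positive root) and `i ≤ j` for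
every simple root `α_j` such that `γ = α_j + δ` for some positive root `δ`. -/
def ChevalleyBasis.IsPositive {ι k M N : Type*} [Finite ι] [Field k] [CharZero k]
    [AddCommGroup M] [Module k M] [AddCommGroup N] [Module k N]
    {P : RootPairing ι k M N} [P.IsCrystallographic] {b : P.Base}
    {R V : Type*} [CommRing R] [LieRing V] [LieAlgebra R V] (c : ChevalleyBasis b R V)
    {l : ℕ} (α : Fin l ≃ b.support) : Prop :=
  ∀ (i : Fin l) (β γ : ι), b.IsPos β → b.IsPos γ → P.root γ = P.root (α i) + P.root β →
    (∀ (j : Fin l) (δ : ι), b.IsPos δ → P.root γ = P.root (α j) + P.root δ → i ≤ j) →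
    c.N (α i) β = 1

/-! Induct on the height of `γ = β + α_i`. Let `m` be least with `δ = γ - α_m` a positive root;
positivity gives `N (α m) δ = 1`. If `m = i`, it remains to see that the support of `β` is not
entirely below `i`. If `m < i` and `α_i`, `α_m` are not orthogonal, then `γ = α_i + α_m` and
antisymmetry gives `-1`. Otherwise `η = γ - α_i - α_m` is a root and the Jacobi identity reads `N (α
m) η * N (α i) β = N (α i) η * N (α m) δ`. Once `N (α m) η = 1`, the sign passes from `β` to `η`,
whose support differs from that of `β` at most by `m < i`.

That value is where the numbering matters: each node has at most one larger neighbour, so the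
support of a root has a single node with no larger neighbour in the support. Were the support of `η`
below `m`, this node would be joined to both `m` and `i`. -/

theorem SimplyLacedType.cartanMatrix_symm {l : ℕ} (t : SimplyLacedType l) (i j : Fin l) :
    t.cartanMatrix i j = t.cartanMatrix j i := by
  cases t with
  | A => exact (CartanMatrix.A_isSymm l).apply j i
  | D => exact (CartanMatrix.D_isSymm l).apply j.rev i.rev
  | E6 => exact CartanMatrix.E₆_isSymm.apply j i
  | E7 => exact CartanMatrix.E₇_isSymm.apply j i
  | E8 => exact CartanMatrix.E₈_isSymm.apply j i

/-- In the standard numbering, every node has at most one neighbour with a larger number. -/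
theorem SimplyLacedType.eq_of_lt_of_cartanMatrix_ne_zero {l : ℕ} (t : SimplyLacedType l)
    {u v w : Fin l} (huv : u < v) (huw : u < w)
    (hv : t.cartanMatrix u v ≠ 0) (hw : t.cartanMatrix u w ≠ 0) : v = w := by
  cases t with
  | A l hl =>
    simp only [cartanMatrix, CartanMatrix.A, Matrix.of_apply] at hv hw
    grind
  | D l hl =>
    -- Counting from 0, the larger neighbour of node 0 is the branch node 2; that of any other node
    -- is its successor.
    have key (v : Fin l) (huv : u < v) (h : CartanMatrix.D l u.rev v.rev ≠ 0) :
        v.val = if u.val = 0 then 2 else u.val + 1 := by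
      simp only [CartanMatrix.D, Matrix.of_apply, Fin.rev_inj, Fin.val_rev] at h
      split_ifs at h ⊢ <;> omega
    exact Fin.ext ((key v huv hv).trans (key w huw hw).symm)
  | E6 =>
    fin_cases u <;> fin_cases v <;> simp [cartanMatrix, CartanMatrix.E₆] at * <;>
      fin_cases w <;> simp_all
  | E7 =>
    fin_cases u <;> fin_cases v <;> simp [cartanMatrix, CartanMatrix.E₇] at * <;>
      fin_cases w <;> simp_all
  | E8 =>
    fin_cases u <;> fin_cases v <;> simp [cartanMatrix, CartanMatrix.E₈] at * <;>
      fin_cases w <;> simp_all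

namespace RootPairing

/-! ### Pairings of roots when all roots have the same length -/

section Pairing

variable {ι k M N : Type*} [Finite ι] [Field k] [CharZero k]
  [AddCommGroup M] [Module k M] [AddCommGroup N] [Module k N]
  {P : RootPairing ι k M N} [P.IsCrystallographic]

/-- If the Cartan matrix is symmetric then so is the pairing of all roots and coroots. -/
theorem Base.pairing_symm_of_cartanMatrix_symm [P.IsRootSystem] [P.IsReduced] (b : P.Base)
    (h : ∀ i j, b.cartanMatrix i j = b.cartanMatrix j i) (x y : ι) :
    P.pairing x y = P.pairing y x := by
  -- By symmetry of the Cartan matrix `φ` commutes with the simple reflections, hence sends every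
  -- root to its coroot.
  let φ : M →ₗ[k] N := b.toWeightBasis.constr k fun i ↦ P.coroot i
  have hφ (i : b.support) : φ (P.root i) = P.coroot i := by
    rw [← b.toWeightBasis_apply i, Module.Basis.constr_basis]
  have hsimple (i : b.support) (m : M) :
      P.toLinearMap (P.root i) (φ m) = P.toLinearMap m (P.coroot i) := by
    suffices P.toLinearMap (P.root i) ∘ₗ φ = P.toLinearMap.flip (P.coroot i) from
      LinearMap.congr_fun this m
    refine b.toWeightBasis.ext fun j ↦ ?_
    have := congrArg (algebraMap ℤ k) (h i j)
    simp only [Base.cartanMatrix, Base.algebraMap_cartanMatrixIn_apply] at this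
    simpa [hφ] using this
  have hall (x : ι) : φ (P.root x) = P.coroot x := by
    refine b.induction_reflect x (p := fun x ↦ φ (P.root x) = P.coroot x)
      (fun i hi ↦ by simp [hi]) (fun i hi ↦ hφ ⟨i, hi⟩) ?_
    intro i j hi hj
    have := hsimple ⟨j, hj⟩ (P.root i)
    rw [hi] at this
    simp only [root_coroot_eq_pairing] at this
    rw [root_reflectionPerm, coroot_reflectionPerm, reflection_apply_root,
      coreflection_apply_coroot, map_sub, map_smul, hi, hφ ⟨j, hj⟩, this]
  suffices P.toLinearMap.flip (P.coroot y) = P.toLinearMap (P.root y) ∘ₗ φ by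
    simpa [hall] using LinearMap.congr_fun this (P.root x)
  refine b.toWeightBasis.ext fun j ↦ ?_
  simpa [hφ, hall] using hsimple j (P.root y)

omit [Finite ι] in
theorem pairingIn_symm_of_pairing_symm (h : ∀ x y, P.pairing x y = P.pairing y x) (x y : ι) :
    P.pairingIn ℤ x y = P.pairingIn ℤ y x :=
  FaithfulSMul.algebraMap_injective ℤ k <| by
    rw [algebraMap_pairingIn, algebraMap_pairingIn, h]

theorem pairingIn_mem_of_symm [P.IsReduced] (h : ∀ x y, P.pairing x y = P.pairing y x) (x y : ι) :
    P.pairingIn ℤ x y ∈ Set.Icc (-2 : ℤ) 2 ∧ (P.pairingIn ℤ x y = 2 → x = y) ∧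
      (P.pairingIn ℤ x y = -2 → P.root x = -P.root y) := by
  have hs := pairingIn_symm_of_pairing_symm h x y
  have hmem := P.pairingIn_pairingIn_mem_set_of_isCrystal_of_isRed x y
  have : Module.IsReflexive k M := .of_isPerfPair P.toLinearMap
  have h2 := P.pairingIn_two_two_iff ℤ x y
  have h2' := P.pairingIn_neg_two_neg_two_iff ℤ x y
  simp only [Set.mem_insert_iff, Set.mem_singleton_iff, Prod.mk.injEq, ← hs, and_self]
    at hmem h2 h2'
  exact ⟨by rw [Set.mem_Icc]; omega, h2.1, h2'.1⟩

theorem pairingIn_eq_neg_one_of_root_eq_add [P.IsReduced]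
    (h : ∀ x y, P.pairing x y = P.pairing y x) {x y z : ι}
    (hz : P.root z = P.root x + P.root y) : P.pairingIn ℤ x y = -1 := by
  have h1 := pairingIn_eq_add_of_root_eq_add (S := ℤ) (j := y) hz
  rw [pairingIn_same] at h1
  obtain ⟨hzy, hzy2, -⟩ := pairingIn_mem_of_symm h z y
  obtain ⟨hxy, -, hxy2⟩ := pairingIn_mem_of_symm h x y
  rw [Set.mem_Icc] at hzy hxy
  have h0 : P.pairingIn ℤ x y ≠ 0 := by
    intro h0
    obtain rfl := hzy2 (by omega)
    exact P.ne_zero x (by simpa using hz)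
  have h2 : P.pairingIn ℤ x y ≠ -2 := by
    intro h2
    exact P.ne_zero z (by rw [hz, hxy2 h2, neg_add_cancel])
  omega

/-! ### Supports of positive roots -/

namespace Base

variable [P.IsRootSystem] {b : P.Base}

theorem IsPos.exists_nat_repr {x : ι} (hx : b.IsPos x) :
    ∃ n : b.support → ℕ, ∀ j, b.toWeightBasis.repr (P.root x) j = n j := by
  classical
  refine hx.induction_on_add
    (p := fun x ↦ ∃ n : b.support → ℕ, ∀ j, b.toWeightBasis.repr (P.root x) j = n j)
    (fun i hi ↦ ⟨Pi.single ⟨i, hi⟩ 1, fun j ↦ ?_⟩) ?_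
  · have := b.toWeightBasis_repr_root ⟨i, hi⟩
    simp only at this
    rw [this, Finsupp.single_apply, Pi.single_apply]
    simp [eq_comm]
  · rintro x y z hz ⟨n, hn⟩ hy
    refine ⟨n + Pi.single ⟨y, hy⟩ 1, fun j ↦ ?_⟩
    have := b.toWeightBasis_repr_root ⟨y, hy⟩
    simp only at this
    rw [hz, map_add, Finsupp.add_apply, this, hn, Finsupp.single_apply]
    simp [Pi.single_apply, eq_comm]

omit [Finite ι] [P.IsCrystallographic] in
theorem repr_root_ne_zero_iff (i j : b.support) :
    b.toWeightBasis.repr (P.root i) j ≠ 0 ↔ j = i := by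
  classical
  rw [toWeightBasis_repr_root, Finsupp.single_apply]
  simp [eq_comm]

theorem IsPos.repr_add_ne_zero_iff {x z : ι} (hx : b.IsPos x) {i : b.support}
    (hz : P.root z = P.root x + P.root i) (j : b.support) :
    b.toWeightBasis.repr (P.root z) j ≠ 0 ↔
      b.toWeightBasis.repr (P.root x) j ≠ 0 ∨ j = i := by
  classical
  obtain ⟨n, hn⟩ := hx.exists_nat_repr
  rw [hz, map_add, Finsupp.add_apply, toWeightBasis_repr_root, hn, Finsupp.single_apply]
  by_cases hij : i = j
  · simp only [hij, if_true, or_true, iff_true]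
    exact_mod_cast (n j).succ_ne_zero
  · simp [hij, Ne.symm hij]

theorem IsPos.exists_pairingIn_eq_sum {x : ι} (hx : b.IsPos x) :
    ∃ n : b.support → ℕ, (∀ j, b.toWeightBasis.repr (P.root x) j ≠ 0 ↔ n j ≠ 0) ∧
      ∀ y, P.pairingIn ℤ x y = ∑ j, n j * P.pairingIn ℤ j y := by
  obtain ⟨n, hn⟩ := hx.exists_nat_repr
  refine ⟨n, fun j ↦ by rw [hn]; simp, fun y ↦ FaithfulSMul.algebraMap_injective ℤ k ?_⟩
  have := congrArg (P.toLinearMap.flip (P.coroot y)) (b.toWeightBasis.sum_repr (P.root x))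
  simp only [hn, toWeightBasis_apply, map_sum, map_smul, coroot_root_eq_pairing,
    smul_eq_mul] at this
  rw [algebraMap_pairingIn, ← this, map_sum]
  simp only [map_mul, map_natCast, algebraMap_pairingIn]

theorem IsPos.exists_pairingIn_pos {x y : ι} (hx : b.IsPos x) (h : 0 < P.pairingIn ℤ x y) :
    ∃ j : b.support, b.toWeightBasis.repr (P.root x) j ≠ 0 ∧ 0 < P.pairingIn ℤ j y := by
  obtain ⟨n, hn, hsum⟩ := hx.exists_pairingIn_eq_sum
  rw [hsum] at h
  obtain ⟨j, -, hj⟩ := Finset.exists_lt_of_sum_lt (f := fun _ ↦ (0 : ℤ)) (by simpa using h)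
  refine ⟨j, (hn j).2 ?_, pos_of_mul_pos_right hj (by positivity)⟩
  rintro h0
  simp [h0] at hj

theorem IsPos.exists_pairingIn_neg {x y : ι} (hx : b.IsPos x) (h : P.pairingIn ℤ x y < 0) :
    ∃ j : b.support, b.toWeightBasis.repr (P.root x) j ≠ 0 ∧ P.pairingIn ℤ j y < 0 := by
  obtain ⟨n, hn, hsum⟩ := hx.exists_pairingIn_eq_sum
  rw [hsum] at h
  obtain ⟨j, -, hj⟩ := Finset.exists_lt_of_sum_lt (g := fun _ ↦ (0 : ℤ)) (by simpa using h)
  refine ⟨j, (hn j).2 ?_, neg_of_mul_neg_right hj (by positivity)⟩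
  rintro h0
  simp [h0] at hj

/-- If every simple root has at most one larger neighbour, then the support of a positive root
contains at most one simple root without a larger neighbour in the support. -/
theorem IsPos.eq_of_forall_lt_pairingIn_eq_zero [P.IsReduced]
    (hsymm : ∀ x y, P.pairing x y = P.pairing y x) {l : ℕ} (α : Fin l ≃ b.support)
    (hα : ∀ u v w : Fin l, u < v → u < w → P.pairingIn ℤ (α u) (α v) ≠ 0 →
      P.pairingIn ℤ (α u) (α w) ≠ 0 → v = w)
    {x : ι} (hx : b.IsPos x) {v w : Fin l}
    (hv : b.toWeightBasis.repr (P.root x) (α v) ≠ 0)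
    (hw : b.toWeightBasis.repr (P.root x) (α w) ≠ 0)
    (hv' : ∀ u, b.toWeightBasis.repr (P.root x) (α u) ≠ 0 → v < u →
      P.pairingIn ℤ (α v) (α u) = 0)
    (hw' : ∀ u, b.toWeightBasis.repr (P.root x) (α u) ≠ 0 → w < u →
      P.pairingIn ℤ (α w) (α u) = 0) : v = w := by
  let p (x : ι) : Prop := b.IsPos x ∧ ∀ v w : Fin l,
    b.toWeightBasis.repr (P.root x) (α v) ≠ 0 → b.toWeightBasis.repr (P.root x) (α w) ≠ 0 →
    (∀ u, b.toWeightBasis.repr (P.root x) (α u) ≠ 0 → v < u → P.pairingIn ℤ (α v) (α u) = 0) →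
    (∀ u, b.toWeightBasis.repr (P.root x) (α u) ≠ 0 → w < u → P.pairingIn ℤ (α w) (α u) = 0) →
    v = w
  suffices p x from this.2 v w hv hw hv' hw'
  clear hv hw hv' hw' v w
  refine hx.induction_on_add ?_ ?_
  · intro i hi
    refine ⟨isPos_of_mem_support hi, fun v w hv hw _ _ ↦ α.injective ?_⟩
    rw [(repr_root_ne_zero_iff ⟨i, hi⟩ _).1 hv, (repr_root_ne_zero_iff ⟨i, hi⟩ _).1 hw]
  · rintro x y z hz ⟨hx, ih⟩ hy
    obtain ⟨j, hj⟩ := α.surjective ⟨y, hy⟩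
    obtain rfl : (α j : ι) = y := by rw [hj]
    refine ⟨hx.add (isPos_of_mem_support hy) hz, ?_⟩
    simp only [hx.repr_add_ne_zero_iff hz, α.injective.eq_iff]
    by_cases hxj : b.toWeightBasis.repr (P.root x) (α j) ≠ 0
    · have (u : Fin l) : (b.toWeightBasis.repr (P.root x) (α u) ≠ 0 ∨ u = j) ↔
          b.toWeightBasis.repr (P.root x) (α u) ≠ 0 := by
        constructor
        · rintro (h | rfl)
          exacts [h, hxj]
        · exact Or.inl
      simpa only [this] using ih
    obtain ⟨a, ha, haj⟩ := hx.exists_pairingIn_neg (y := (α j : ι)) (by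
      rw [pairingIn_eq_neg_one_of_root_eq_add hsymm hz]; norm_num)
    obtain ⟨a, rfl⟩ := α.surjective a
    have key (w : Fin l) (hwj : w ≠ j)
        (hw : b.toWeightBasis.repr (P.root x) (α w) ≠ 0 ∨ w = j)
        (hj' : ∀ u, b.toWeightBasis.repr (P.root x) (α u) ≠ 0 ∨ u = j → j < u →
          P.pairingIn ℤ (α j) (α u) = 0)
        (hw' : ∀ u, b.toWeightBasis.repr (P.root x) (α u) ≠ 0 ∨ u = j → w < u →
          P.pairingIn ℤ (α w) (α u) = 0) : False := by
      -- If `a < j`, the only larger neighbour of `a` is `j`, outside the old support. So `a` was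
      -- the old top node, whence `w = a`, which now has the larger neighbour `j`.
      rcases lt_trichotomy a j with h | rfl | h
      · have := ih w a (hw.resolve_right hwj) ha (fun u hu ↦ hw' u (.inl hu)) fun u hu hau ↦ by
          by_contra hne
          exact hxj (hα a u j hau h hne haj.ne ▸ hu)
        subst this
        exact haj.ne (hw' j (.inr rfl) h)
      · exact hxj ha
      · have := hj' a (.inl ha) h
        rw [P.pairingIn_eq_zero_iff] at this
        exact haj.ne this
    intro v w hv hw hv' hw'
    by_cases hvj : v = j <;> by_cases hwj : w = j
    · rw [hvj, hwj]
    · exact (key w hwj hw (hvj ▸ hv') hw').elim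
    · exact (key v hvj hv (hwj ▸ hw') hv').elim
    · exact ih v w (hv.resolve_right hvj) (hw.resolve_right hwj)
        (fun u hu ↦ hv' u (.inl hu)) (fun u hu ↦ hw' u (.inl hu))

end Base

end Pairing

end RootPairing

/-! ### Signs of the structure constants -/

namespace ChevalleyBasis

variable {ι k M N : Type*} [Finite ι] [Field k] [CharZero k]
  [AddCommGroup M] [Module k M] [AddCommGroup N] [Module k N]
  {P : RootPairing ι k M N} [P.IsCrystallographic] {b : P.Base}
  {R V : Type*} [CommRing R] [LieRing V] [LieAlgebra R V] (c : ChevalleyBasis b R V)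

/-- Signs can be read off in `V` because `1 ≠ -1` in `R`. -/
theorem eq_of_zsmul_e_eq (hR : (2 : R) ≠ 0) {x : ι} {m n : ℤ}
    (hm : m = 1 ∨ m = -1) (hn : n = 1 ∨ n = -1) (h : m • c.e x = n • c.e x) : m = n := by
  have : Nontrivial R := ⟨2, 0, hR⟩
  have hli : LinearIndependent R c.e := c.linearIndependent.comp Sum.inl Sum.inl_injective
  have hinj := hli.smul_left_injective x
  have hmn : (m : R) = n := hinj (by simpa [Int.cast_smul_eq_zsmul] using h)
  have h1 : (1 : R) ≠ -1 := fun h ↦ hR (by linear_combination h)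
  rcases hm with rfl | rfl <;> rcases hn with rfl | rfl <;> simp_all [eq_comm]

theorem N_swap (hR : (2 : R) ≠ 0) {x y z : ι} (hz : P.root z = P.root x + P.root y) :
    c.N x y = -c.N y x := by
  have hz' : P.root z = P.root y + P.root x := by rw [hz, add_comm]
  refine c.eq_of_zsmul_e_eq hR (c.N_eq_one_or x y z hz) ?_ ?_ (x := z)
  · have := c.N_eq_one_or y x z hz'
    omega
  · rw [neg_smul, ← c.lie_e_e x y z hz, ← c.lie_e_e y x z hz', lie_skew]

/-- The Jacobi identity for three root vectors, two of which commute. -/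
theorem N_mul_N_of_lie_eq_zero (hR : (2 : R) ≠ 0) {x y w u v z : ι}
    (hxy : ⁅c.e x, c.e y⁆ = 0) (hu : P.root u = P.root y + P.root w)
    (hv : P.root v = P.root x + P.root w) (hz : P.root z = P.root x + P.root u) :
    c.N y w * c.N x u = c.N x w * c.N y v := by
  have hz' : P.root z = P.root y + P.root v := by rw [hz, hu, hv]; abel
  have h := leibniz_lie (c.e x) (c.e y) (c.e w)
  rw [hxy, zero_lie, zero_add, c.lie_e_e y w u hu, c.lie_e_e x w v hv, lie_zsmul, lie_zsmul,
    c.lie_e_e x u z hz, c.lie_e_e y v z hz', smul_smul, smul_smul] at h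
  have h1 := c.N_eq_one_or y w u hu
  have h2 := c.N_eq_one_or x u z hz
  have h3 := c.N_eq_one_or x w v hv
  have h4 := c.N_eq_one_or y v z hz'
  refine c.eq_of_zsmul_e_eq hR ?_ ?_ h
  · rcases h1 with h1 | h1 <;> rcases h2 with h2 | h2 <;> simp [h1, h2]
  · rcases h3 with h1 | h1 <;> rcases h4 with h2 | h2 <;> simp [h1, h2]

variable {c} in
open RootPairing RootPairing.Base in
-- Both implications are carried through the induction: the first gives `N (α m) η = 1`, and both
-- are needed to evaluate `N (α i) η`.
theorem IsPositive.N_eq [P.IsRootSystem] [P.IsReduced] (hR : (2 : R) ≠ 0)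
    {l : ℕ} {α : Fin l ≃ b.support} (hc : c.IsPositive α)
    (hsymm : ∀ x y, P.pairing x y = P.pairing y x)
    (hα : ∀ u v w : Fin l, u < v → u < w → P.pairingIn ℤ (α u) (α v) ≠ 0 →
      P.pairingIn ℤ (α u) (α w) ≠ 0 → v = w)
    (i : Fin l) {β γ : ι} (hβ : b.IsPos β) (hγ : P.root γ = P.root β + P.root (α i)) :
    ((∃ j, b.toWeightBasis.repr (P.root β) (α j) ≠ 0 ∧ i ≤ j) → c.N (α i) β = 1) ∧
      ((∀ j, b.toWeightBasis.repr (P.root β) (α j) ≠ 0 → j < i) → c.N (α i) β = -1) := by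
  have hsymm' := pairingIn_symm_of_pairing_symm hsymm
  induction hn : (b.height γ).toNat using Nat.strong_induction_on generalizing i β γ with
  | _ n ih =>
  have hαpos (j : Fin l) : b.IsPos (α j) := isPos_of_mem_support (α j).2
  have hγpos : b.IsPos γ := hβ.add (hαpos i) hγ
  have hdesc {j : Fin l} {δ : ι} (h : P.root γ = P.root δ + P.root (α j)) :
      P.pairingIn ℤ γ (α j) = 1 := by
    rw [pairingIn_eq_add_of_root_eq_add (S := ℤ) h, pairingIn_same,
      pairingIn_eq_neg_one_of_root_eq_add hsymm h]
    norm_num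
  have hheight {x z : ι} (j : Fin l) (h : P.root z = P.root x + P.root (α j)) :
      b.height z = b.height x + 1 := by
    rw [b.height_add h, height_one_of_mem_support (α j).2]
  obtain ⟨m, ⟨δ, hδ, hδγ⟩, hmin⟩ := WellFounded.has_min (wellFounded_lt (α := Fin l))
    {j | ∃ δ, b.IsPos δ ∧ P.root γ = P.root δ + P.root (α j)} ⟨i, β, hβ, hγ⟩
  replace hmin (j : Fin l) (η : ι) (hη : b.IsPos η) (h : P.root γ = P.root (α j) + P.root η) :
      m ≤ j := not_lt.1 (hmin j ⟨η, hη, by rw [h, add_comm]⟩)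
  have hNm : c.N (α m) δ = 1 := hc m δ γ hδ hγpos (by rw [hδγ, add_comm]) hmin
  have hmi : m ≤ i := hmin i β hβ (by rw [hγ, add_comm])
  rcases hmi.eq_or_lt with rfl | hmi
  · obtain rfl : δ = β := P.root.injective (by simpa [hγ] using hδγ.symm)
    refine ⟨fun _ ↦ hNm, fun hlt ↦ ?_⟩
    -- Some `α_j` in the support of `δ` pairs positively with `γ`, so `γ - α_j` is a positive root
    -- and minimality gives `m ≤ j`.
    have h1 : 0 < P.pairingIn ℤ δ γ := by
      have h2 := pairingIn_eq_add_of_root_eq_add (S := ℤ) (j := γ) hγ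
      rw [pairingIn_same, hsymm' (α m), hdesc hγ] at h2
      omega
    obtain ⟨v, hv, hvγ⟩ := hδ.exists_pairingIn_pos h1
    obtain ⟨j, rfl⟩ := α.surjective v
    have hjm := hlt j hv
    have hne : γ ≠ α j := by
      rintro rfl
      have := (hδ.repr_add_ne_zero_iff hγ (α m)).2 (.inr rfl)
      rw [repr_root_ne_zero_iff, α.injective.eq_iff] at this
      exact hjm.ne this.symm
    obtain ⟨η, hη⟩ := P.root_sub_root_mem_of_pairingIn_pos (hsymm' _ _ ▸ hvγ) hne
    exact (hjm.not_ge (hmin j η (hγpos.sub (α j).2 hη) (by rw [hη]; abel))).elim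
  have hne : (α i : ι) ≠ α m := fun h ↦ hmi.ne (α.injective (Subtype.ext h)).symm
  have hle := b.pairingIn_le_zero_of_ne hne (α i).2 (α m).2
  have hγm := hdesc hδγ
  have hγi := hdesc hγ
  rcases hle.lt_or_eq with hlt | h0
  · obtain ⟨κ, hκ⟩ := P.root_add_root_mem_of_pairingIn_neg hlt
      (b.root_ne_neg_of_ne (α i).2 (α m).2 hne)
    -- The root `α_i + α_m` pairs with `γ` to `1 + 1 = 2`, which forces equality.
    obtain rfl : κ = γ := by
      refine (pairingIn_mem_of_symm hsymm κ γ).2.1 ?_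
      rw [pairingIn_eq_add_of_root_eq_add (S := ℤ) hκ, hsymm' (α i), hsymm' (α m), hγi, hγm]
      norm_num
    obtain rfl : β = α m := P.root.injective
      (add_right_cancel (b := P.root (α i)) (by rw [← hγ, hκ, add_comm]))
    obtain rfl : δ = α i := P.root.injective
      (add_right_cancel (b := P.root (α m)) (by rw [← hδγ, hκ]))
    refine ⟨?_, fun _ ↦ by rw [c.N_swap hR hκ, hNm]⟩
    rintro ⟨j, hj, hij⟩
    rw [repr_root_ne_zero_iff, α.injective.eq_iff] at hj
    exact (hmi.not_ge (hj ▸ hij)).elim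
  have hβm : P.pairingIn ℤ β (α m) = 1 := by
    rw [pairingIn_eq_add_of_root_eq_add (S := ℤ) hγ, h0, add_zero] at hγm
    exact hγm
  have hβne : β ≠ α m := by
    rintro rfl
    simp at hβm
  obtain ⟨η, hη⟩ := P.root_sub_root_mem_of_pairingIn_pos (by rw [hβm]; norm_num) hβne
  have hηpos : b.IsPos η := hβ.sub (α m).2 hη
  have hηβ : P.root β = P.root η + P.root (α m) := by rw [hη]; abel
  have hηδ : P.root δ = P.root η + P.root (α i) :=
    add_right_cancel (b := P.root (α m)) (by rw [← hδγ, hγ, hηβ]; abel)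
  have hcomm : ⁅c.e (α i), c.e (α m)⁆ = 0 := by
    refine c.lie_e_e_eq_zero _ _ ?_ ?_
    · rintro ⟨κ, hκ⟩
      have := pairingIn_eq_neg_one_of_root_eq_add hsymm hκ
      omega
    · exact fun h ↦ b.root_ne_neg_of_ne (α i).2 (α m).2 hne (eq_neg_of_add_eq_zero_left h)
  have hjac := c.N_mul_N_of_lie_eq_zero hR hcomm (u := β) (v := δ) (w := η) (z := γ)
    (by rw [hηβ, add_comm]) (by rw [hηδ, add_comm]) (by rw [hγ, add_comm])
  have hpos := b.isPos_iff.1 hγpos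
  have ihm := ih _ (by rw [← hn]; have := hheight i hγ; omega) m hηpos hηβ rfl
  have ihi := ih _ (by rw [← hn]; have := hheight m hδγ; omega) i hηpos hηδ rfl
  have hex : ∃ j, b.toWeightBasis.repr (P.root η) (α j) ≠ 0 ∧ m ≤ j := by
    by_contra! hlt
    have hnbr {q : Fin l} (hmq : m ≤ q) {ζ : ι} (h : P.root ζ = P.root η + P.root (α q)) :
        ∃ v, b.toWeightBasis.repr (P.root η) (α v) ≠ 0 ∧ v < q ∧
          P.pairingIn ℤ (α v) (α q) ≠ 0 ∧
          ∀ u, b.toWeightBasis.repr (P.root η) (α u) ≠ 0 → v < u →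
            P.pairingIn ℤ (α v) (α u) = 0 := by
      obtain ⟨v, hv, hvq⟩ := hηpos.exists_pairingIn_neg (y := (α q : ι)) (by
        rw [pairingIn_eq_neg_one_of_root_eq_add hsymm h]; norm_num)
      obtain ⟨v, rfl⟩ := α.surjective v
      have hlt' := (hlt v hv).trans_le hmq
      refine ⟨v, hv, hlt', hvq.ne, fun u hu hvu ↦ ?_⟩
      by_contra hvu'
      have := hα v u q hvu hlt' hvu' hvq.ne
      exact ((hlt u hu).trans_le hmq).ne this
    -- Both `η + α_m` and `η + α_i` are roots, so `m` and `i` each have a neighbour in the support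
    -- of `η`, and each such neighbour is its top node.
    obtain ⟨v, hv, hvm, hvm', hvtop⟩ := hnbr le_rfl hηβ
    obtain ⟨w, hw, hwi, hwi', hwtop⟩ := hnbr hmi.le hηδ
    obtain rfl := hηpos.eq_of_forall_lt_pairingIn_eq_zero hsymm α hα hv hw hvtop hwtop
    exact hmi.ne (hα v m i hvm hwi hvm' hwi')
  rw [ihm.1 hex, hNm, one_mul, mul_one] at hjac
  rw [hjac]
  simp only [hηpos.repr_add_ne_zero_iff hηβ, α.injective.eq_iff]
  refine ⟨?_, fun h ↦ ihi.2 fun j hj ↦ h j (.inl hj)⟩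
  rintro ⟨j, hj | rfl, hij⟩
  · exact ihi.1 ⟨j, hj, hij⟩
  · exact (hmi.not_ge hij).elim

end ChevalleyBasis

theorem theorem1 {ι k M N : Type*} [Finite ι] [Field k] [CharZero k]
    [AddCommGroup M] [Module k M] [AddCommGroup N] [Module k N]
    (P : RootPairing ι k M N) [P.IsRootSystem] [P.IsCrystallographic] [P.IsReduced]
    (b : P.Base) {l : ℕ} (t : SimplyLacedType l) (α : Fin l ≃ b.support)
    (hα : IsStandardNumbering b t α)
    {R V : Type*} [CommRing R] (hR : (2 : R) ≠ 0) [LieRing V] [LieAlgebra R V]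
    (c : ChevalleyBasis b R V) (hc : c.IsPositive α)
    (i : Fin l) (β γ : ι) (hβ : b.IsPos β) (hγ : b.IsPos γ)
    (hsum : P.root γ = P.root β + P.root (α i)) :
    c.N (α i) β = -1 ↔
      ∀ j : Fin l, b.toWeightBasis.repr (P.root β) (α j) ≠ 0 → j < i := by
  have hcart (u v : Fin l) : P.pairingIn ℤ (α u) (α v) = t.cartanMatrix u v := hα u v
  have hsymm := b.pairing_symm_of_cartanMatrix_symm fun u v ↦ by
    obtain ⟨u, rfl⟩ := α.surjective u
    obtain ⟨v, rfl⟩ := α.surjective v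
    rw [hα, hα, t.cartanMatrix_symm]
  obtain ⟨h1, h2⟩ := hc.N_eq hR hsymm (fun u v w huv huw hv hw ↦
    t.eq_of_lt_of_cartanMatrix_ne_zero huv huw (by rwa [← hcart]) (by rwa [← hcart])) i hβ hsum
  refine ⟨fun h ↦ ?_, h2⟩
  by_contra! hex
  have := h1 hex
  omega
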